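/- Let $m\ge1$ and $n\ge0$ be integers, and let $a,\mu,\lambda$ be real numbers with $a\ge(m+3)/2$, $\mu\ge0$ and $0\le\lambda<2m-1$. Let $$S:=\{-a+re^{i\theta}\colon r\ge0,\ |\theta|\le\pi/2\}\subset\mathbb C .$$ Suppose that $f\colon\mathbb R\to\mathbb R$ can be extended to a function (still denoted by $f$) mapping $\mathbb R\cup S$ into $\mathbb C$ that is continuous on $S$, holomorphic in the interior of $S$, and satisfies $|f(z)|\le\mu\,|z+a+1|^\lambda$ for all $z\in S$. Put $$\gamma_{m,j}:=(-1)^{j-1}\,\frac2j\,\binom{2m}{m+j}\Big/\binom{2m}{m}\qquad(j=1,\dots,m),$$ $$R_m:=\frac1{(2m-1)!\,2^{2m+1}}\int_0^1 ds\,(1-s)^{2m-1}\int_{-1}^1 dv\,v^{2m}\sum_{j=1}^m\gamma_{m,j}\,j^{2m+1}\sum_{k=0}^{n-1}f^{(2m)}(k+jsv/2)$$ (where $f^{(2m)}$ is the $2m$-th derivative of the function $f$ of a real variable, and an empty sum is $0$), and $$\Lambda_*:=\max_{0<t<1}\,(1-t)^{t-1}(1+t)^{-1-t}t^2=0.3081\ldots.$$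 If $m\ge2$, then $$|R_m|\le\frac{1.001\,\pi\,\mu\,3^\lambda}{(2m+1)(2m-1-\lambda)}\Big(\frac{\Lambda_*}4\Big)^m\frac{m^{2m+1}}{(a-m/2-1/2)^{2m-1-\lambda}}.$$ If $m=1$, then the same bound holds with $1.0331$ in place of $1.001$. -/

import Mathlib

noncomputable section

namespace AltSum

/-- The closed sector `{-a + r e^{iθ} : r ≥ 0, |θ| ≤ θ₀}` of the complex plane
with vertex at `-a`. -/
def sector (a θ₀ : ℝ) : Set ℂ :=
  {z : ℂ | ∃ r θ : ℝ, 0 ≤ r ∧ |θ| ≤ θ₀ ∧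
    z = -(a : ℂ) + (r : ℂ) * Complex.exp (Complex.I * (θ : ℂ))}

/-- The coefficients `γ_{m,j} = (-1)^{j-1} (2/j) C(2m, m+j) / C(2m, m)`, used for `1 ≤ j ≤ m`. -/
def gam (m j : ℕ) : ℝ :=
  (-1 : ℝ) ^ (j - 1) * (2 / (j : ℝ)) * ((2 * m).choose (m + j) : ℝ) / ((2 * m).choose m : ℝ)

/-- The remainder `R_m` of the alternative summation formula for `∑_{k=0}^{n-1} f k`,
used for `1 ≤ m`. -/
def remainder (m n : ℕ) (f : ℝ → ℝ) : ℝ :=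
  1 / (((2 * m - 1).factorial : ℝ) * 2 ^ (2 * m + 1)) *
    ∫ s in (0 : ℝ)..1, (1 - s) ^ (2 * m - 1) *
      ∫ v in (-1 : ℝ)..1, v ^ (2 * m) *
        ∑ j ∈ Finset.Icc 1 m, gam m j * (j : ℝ) ^ (2 * m + 1) *
          ∑ k ∈ Finset.range n, iteratedDeriv (2 * m) f ((k : ℝ) + (j : ℝ) * s * v / 2)

/-- `Λ(t) = (1-t)^{t-1} (1+t)^{-1-t} t²`. -/
def Lam (t : ℝ) : ℝ := (1 - t) ^ (t - 1) * (1 + t) ^ (-1 - t) * t ^ 2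

/-- `Λ_* = max_{0<t<1} Λ(t) = 0.3081…`. -/
def LamStar : ℝ := sSup (Lam '' Set.Ioo (0 : ℝ) 1)

end AltSum

end

/-!
The remainder is an average of derivatives `f^(2m)` at points `k + j s v / 2 ≥ k - m / 2`, and its
bound splits into an analytic factor and a combinatorial one.

*Analytic factor.* The sector of half-angle `π / 2` is the half-plane `re z ≥ -a`. Cauchy's
estimate on the disc of radius `x + a` around `x` gives
`|f^(2m)(x)| ≤ (2m)! μ 3^lam (x + a)^(lam - 2m)` (`abs_iteratedDeriv_le`). By convexity each term
of the sum over `k` is at most the integral of the power over a unit interval centred at that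
point, and these integrals telescope (`sum_rpow_neg_le`). This yields the factor
`(a - m/2 - 1/2)^(-(2m - 1 - lam)) / (2m - 1 - lam)`.

*Combinatorial factor.* What remains is
`∑ |γ_{m,j}| j^(2m+1) = (2 / C(2m,m)) ∑ C(2m,m+j) j^(2m) ≤ C π Λ_*^m m^(2m+1)`, with `C = 1.001`
for `m ≥ 2` and `C = 1.0331` for `m = 1`.
From `t ≤ exp (t - 1)` with `t = j x / m` and the binomial theorem,
`∑ C(2m,m+j) j^(2m) ≤ 4^m m^(2m) (cosh x / (e x))^(2m)` for every `x > 0`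
(`sum_choose_mul_pow_le`). When `x tanh x = 1`, the quantity `(cosh x / (e x))^2` is exactly
`Λ (tanh x) ≤ Λ_*` (`Lam_tanh`). Since `2 * 4^m ≤ 3 m C(2m,m)` for `m ≥ 2` and `3 < 1.001 π`, this
case follows (`sum_abs_gam_le`). For `m = 1` the sum is `1`, and the claim `1 ≤ 1.0331 π Λ_*` is
checked numerically through `Λ (5 / 6)` (`one_le_mul_lamStar`).
-/

open Real

/-! ### The extremal value `Λ_*` -/

/-- Needed because `LamStar` is a real `sSup`, which would be `0` on an unbounded set. -/
theorem lamStar_bddAbove : BddAbove (AltSum.Lam '' Set.Ioo (0 : ℝ) 1) := by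
  refine ⟨Real.exp 1, ?_⟩
  rintro _ ⟨t, ⟨h0, h1⟩, rfl⟩
  have hu : 0 < 1 - t := by linarith
  have h2 : (1 - t) ^ (t - 1) ≤ Real.exp 1 := by
    rw [Real.rpow_def_of_pos hu]
    gcongr
    have := Real.one_sub_inv_le_log_of_pos hu
    have h3 : (1 - t) * (1 - (1 - t)⁻¹) ≤ (1 - t) * Real.log (1 - t) := by gcongr
    rw [mul_sub, mul_inv_cancel₀ hu.ne'] at h3
    nlinarith
  have h4 : (1 + t) ^ (-1 - t) ≤ 1 :=
    Real.rpow_le_one_of_one_le_of_nonpos (by linarith) (by linarith)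
  have h5 : t ^ 2 ≤ 1 := by nlinarith
  calc AltSum.Lam t ≤ Real.exp 1 * 1 * 1 := by
        unfold AltSum.Lam
        have : 0 ≤ (1 + t) ^ (-1 - t) := by positivity
        gcongr
    _ = _ := by ring

theorem Lam_le_lamStar {t : ℝ} (h0 : 0 < t) (h1 : t < 1) : AltSum.Lam t ≤ AltSum.LamStar :=
  le_csSup lamStar_bddAbove ⟨t, ⟨h0, h1⟩, rfl⟩

theorem exists_mul_tanh_eq_one : ∃ x : ℝ, 0 < x ∧ x * Real.tanh x = 1 := by
  have hc : ContinuousOn (fun x : ℝ => x * Real.sinh x - Real.cosh x) (Set.Icc 0 2) := by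
    fun_prop
  have h2 : 0 ≤ 2 * Real.sinh 2 - Real.cosh 2 := by
    rw [Real.sinh_eq, Real.cosh_eq]
    have h1 : (2 : ℝ) + 1 ≤ Real.exp 2 := Real.add_one_le_exp 2
    have h3 : Real.exp (-2) ≤ 1 := Real.exp_le_one_iff.2 (by norm_num)
    linarith
  obtain ⟨x, ⟨hx0, -⟩, hx⟩ := intermediate_value_Icc (by norm_num) hc
    (show (0 : ℝ) ∈ Set.Icc _ _ from ⟨by simp, h2⟩)
  refine ⟨x, lt_of_le_of_ne hx0 ?_, ?_⟩
  · rintro rfl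
    simp at hx
  · have := Real.cosh_pos x
    rw [Real.tanh_eq_sinh_div_cosh]
    field_simp
    simpa [sub_eq_zero] using hx

/-- At the critical point `t = tanh x = 1 / x` the value of `Λ` is the minimum over `x > 0` of
`(cosh x / (e x)) ^ 2`, which is the quantity produced by the exponential bound on
`∑ j, C(2m, m+j) j ^ (2m)`. -/
theorem Lam_tanh {x : ℝ} (hx : 0 < x) (h : x * Real.tanh x = 1) :
    AltSum.Lam (Real.tanh x) = (Real.cosh x / (x * Real.exp 1)) ^ 2 := by
  have hc := Real.cosh_pos x
  have ht : Real.tanh x = 1 / x := by field_simp; linarith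
  have hs : Real.tanh x * Real.cosh x = Real.sinh x := by
    rw [Real.tanh_eq_sinh_div_cosh]; field_simp
  have e1 : 1 - Real.tanh x = Real.exp (-x - Real.log (Real.cosh x)) := by
    rw [Real.exp_sub, Real.exp_log hc, eq_div_iff hc.ne', sub_mul, hs, one_mul, Real.cosh_sub_sinh]
  have e2 : 1 + Real.tanh x = Real.exp (x - Real.log (Real.cosh x)) := by
    rw [Real.exp_sub, Real.exp_log hc, eq_div_iff hc.ne', add_mul, hs, one_mul, Real.cosh_add_sinh]
  have e3 : (Real.cosh x / (x * Real.exp 1)) ^ 2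
      = Real.exp (2 * Real.log (Real.cosh x) - 2) * (1 / x) ^ 2 := by
    rw [Real.exp_sub, two_mul, Real.exp_add, Real.exp_log hc,
      show (2 : ℝ) = 1 + 1 by norm_num, Real.exp_add]
    field_simp
  rw [AltSum.Lam, e1, e2, ← Real.exp_mul, ← Real.exp_mul, ← Real.exp_add, e3, ← ht]
  congr 2
  linear_combination (-2) * h

/-! ### The coefficient sum `∑ |γ_{m,j}| j ^ (2m+1)` -/

/-- Chernoff-type bound, valid for every `x > 0`: replace `j ^ (2m)` by a multiple of `exp (2jx)`
and sum with the binomial theorem. -/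
theorem sum_choose_mul_pow_le {m : ℕ} {x : ℝ} (hm : 0 < m) (hx : 0 < x) :
    ∑ j ∈ Finset.Icc 1 m, ((2 * m).choose (m + j) : ℝ) * (j : ℝ) ^ (2 * m) ≤
      4 ^ m * (m : ℝ) ^ (2 * m) * ((Real.cosh x / (x * Real.exp 1)) ^ 2) ^ m := by
  have hm' : (0 : ℝ) < m := by exact_mod_cast hm
  have key : ∀ j : ℕ, (j : ℝ) ^ (2 * m) ≤
      (m / (x * Real.exp 1)) ^ (2 * m) * Real.exp (2 * (j * x)) := by
    intro j
    -- `t ≤ exp (t - 1)`, which is sharp at `t = j x / m = 1`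
    have h1 : (j * x / m : ℝ) ≤ Real.exp (j * x / m - 1) := by
      linarith [Real.add_one_le_exp (j * x / m - 1)]
    have h2 : (j : ℝ) ≤ m / (x * Real.exp 1) * Real.exp (j * x / m) := by
      rw [Real.exp_sub] at h1
      calc (j : ℝ) = (j * x / m) * (m / x) := by field_simp
        _ ≤ (Real.exp (j * x / m) / Real.exp 1) * (m / x) := by gcongr
        _ = _ := by field_simp
    calc (j : ℝ) ^ (2 * m) ≤ (m / (x * Real.exp 1) * Real.exp (j * x / m)) ^ (2 * m) := by gcongr
      _ = _ := by
        rw [mul_pow, ← Real.exp_nat_mul]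
        congr 2
        push_cast
        field_simp
  have binom : ∑ j ∈ Finset.Icc 1 m, ((2 * m).choose (m + j) : ℝ) * Real.exp (2 * (j * x)) ≤
      (2 * Real.cosh x) ^ (2 * m) := by
    have h1 : (2 * Real.cosh x) ^ (2 * m) = ∑ i ∈ Finset.range (2 * m + 1),
        Real.exp x ^ i * Real.exp (-x) ^ (2 * m - i) * ((2 * m).choose i : ℝ) := by
      rw [← add_pow, Real.cosh_eq]
      congr 1
      ring
    have hinj : Set.InjOn (fun j => m + j) (Finset.Icc 1 m : Set ℕ) := fun a _ b _ h => by
      simpa using h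
    rw [h1]
    calc _ = ∑ i ∈ (Finset.Icc 1 m).image (fun j => m + j),
        Real.exp x ^ i * Real.exp (-x) ^ (2 * m - i) * ((2 * m).choose i : ℝ) := by
          rw [Finset.sum_image hinj]
          refine Finset.sum_congr rfl fun j hj => ?_
          have hj' := (Finset.mem_Icc.1 hj).2
          rw [mul_comm, ← Real.exp_nat_mul, ← Real.exp_nat_mul, ← Real.exp_add,
            show 2 * m - (m + j) = m - j by omega, Nat.cast_sub hj']
          congr 2
          push_cast
          ring
      _ ≤ _ := by
          refine Finset.sum_le_sum_of_subset_of_nonneg ?_ fun _ _ _ => by positivity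
          intro i hi
          simp only [Finset.mem_image, Finset.mem_Icc, Finset.mem_range] at hi ⊢
          omega
  calc _ ≤ ∑ j ∈ Finset.Icc 1 m, (m / (x * Real.exp 1)) ^ (2 * m) *
        (((2 * m).choose (m + j) : ℝ) * Real.exp (2 * (j * x))) := by
        refine Finset.sum_le_sum fun j _ => ?_
        rw [mul_left_comm]
        gcongr
        exact key j
    _ ≤ (m / (x * Real.exp 1)) ^ (2 * m) * (2 * Real.cosh x) ^ (2 * m) := by
        rw [← Finset.mul_sum]
        gcongr
    _ = _ := by
        rw [← pow_mul, show (4 : ℝ) = 2 ^ 2 by norm_num, ← pow_mul, ← mul_pow, ← mul_pow, ← mul_pow]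
        congr 1
        field_simp

/-- The elementary constant `3` already lies below `1.001 π`, so no Stirling asymptotics for
`centralBinom` are needed. The inequality fails at `m = 1`. -/
theorem two_mul_four_pow_le_mul_centralBinom {m : ℕ} (hm : 2 ≤ m) :
    2 * 4 ^ m ≤ 3 * m * m.centralBinom := by
  induction m, hm using Nat.le_induction with
  | base => decide
  | succ m hm ih =>
    have h := Nat.succ_mul_centralBinom_succ m
    calc 2 * 4 ^ (m + 1) = 4 * (2 * 4 ^ m) := by ring
      _ ≤ 4 * (3 * m * m.centralBinom) := by gcongr
      _ ≤ 3 * (2 * (2 * m + 1) * m.centralBinom) := by nlinarith [m.centralBinom.zero_le]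
      _ = _ := by rw [← h]; ring

theorem abs_gam_mul_pow {m j : ℕ} (hj : 1 ≤ j) :
    |AltSum.gam m j| * (j : ℝ) ^ (2 * m + 1) =
      2 / (m.centralBinom : ℝ) * (((2 * m).choose (m + j) : ℝ) * (j : ℝ) ^ (2 * m)) := by
  have hj' : (0 : ℝ) < j := by exact_mod_cast hj
  rw [AltSum.gam, Nat.centralBinom, abs_div, abs_mul, abs_mul, abs_neg_one_pow, one_mul,
    abs_of_pos (show 0 < 2 / (j : ℝ) by positivity), Nat.abs_cast, Nat.abs_cast, pow_succ]
  field_simp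

theorem sum_abs_gam_le {m : ℕ} (hm : 2 ≤ m) :
    ∑ j ∈ Finset.Icc 1 m, |AltSum.gam m j| * (j : ℝ) ^ (2 * m + 1) ≤
      1.001 * π * AltSum.LamStar ^ m * (m : ℝ) ^ (2 * m + 1) := by
  obtain ⟨x, hx, hxt⟩ := exists_mul_tanh_eq_one
  have hL : (Real.cosh x / (x * Real.exp 1)) ^ 2 ≤ AltSum.LamStar := by
    rw [← Lam_tanh hx hxt]
    exact Lam_le_lamStar (pos_of_mul_pos_right (hxt ▸ one_pos) hx.le) (Real.tanh_lt_one x)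
  have hL0 : 0 ≤ AltSum.LamStar := (sq_nonneg _).trans hL
  have hC : (0 : ℝ) < m.centralBinom := by exact_mod_cast m.centralBinom_pos
  have h4 : (2 * 4 ^ m : ℝ) ≤ 3 * m * m.centralBinom := by
    exact_mod_cast two_mul_four_pow_le_mul_centralBinom hm
  rw [Finset.sum_congr rfl fun j hj => abs_gam_mul_pow (Finset.mem_Icc.1 hj).1, ← Finset.mul_sum]
  calc _ ≤ 2 / (m.centralBinom : ℝ) * (4 ^ m * (m : ℝ) ^ (2 * m) * AltSum.LamStar ^ m) := by
        gcongr
        refine (sum_choose_mul_pow_le (by omega) hx).trans ?_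
        gcongr
    _ = (2 * 4 ^ m) / (m.centralBinom : ℝ) * ((m : ℝ) ^ (2 * m) * AltSum.LamStar ^ m) := by ring
    _ ≤ (1.001 * π * m) * ((m : ℝ) ^ (2 * m) * AltSum.LamStar ^ m) := by
        gcongr
        rw [div_le_iff₀ hC]
        refine h4.trans ?_
        gcongr
        linarith [Real.pi_gt_three]
    _ = _ := by ring

/-- The coefficient bound for `m = 1`, where the coefficient sum equals `1`. The margin is about
`3e-5`. -/
theorem one_le_mul_lamStar : 1 ≤ 1.0331 * π * AltSum.LamStar := by
  -- `5 / 6` is close to the maximizer `0.8336…`, and `Λ (5 / 6) ^ 6` is rational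
  have hL : AltSum.Lam (5 / 6) ≤ AltSum.LamStar := Lam_le_lamStar (by norm_num) (by norm_num)
  have h6 : AltSum.Lam (5 / 6) ^ 6 = 6 * (6 / 11) ^ 11 * (25 / 36) ^ 6 := by
    rw [AltSum.Lam, mul_pow, mul_pow, ← Real.rpow_mul_natCast (by norm_num),
      ← Real.rpow_mul_natCast (by norm_num),
      show ((5 : ℝ) / 6 - 1) * (6 : ℕ) = (-1 : ℤ) by norm_num,
      show (-1 - (5 : ℝ) / 6) * (6 : ℕ) = (-11 : ℤ) by norm_num,
      Real.rpow_intCast, Real.rpow_intCast]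
    norm_num
  have h0 : 0 ≤ AltSum.Lam (5 / 6) := by unfold AltSum.Lam; positivity
  have h1 : 1 ≤ 1.0331 * 3.141592 * AltSum.Lam (5 / 6) := by
    refine (one_le_pow_iff_of_nonneg (by positivity) (show 6 ≠ 0 by norm_num)).1 ?_
    rw [mul_pow, h6]
    norm_num
  refine h1.trans ?_
  have := Real.pi_gt_d6.le
  gcongr

/-! ### Comparing a sum of negative powers with an integral -/

/-- Midpoint (Hermite–Hadamard) inequality for the convex function `t ↦ t ^ (-p)`: the right side
is its integral over `[y - 1/2, y + 1/2]`. -/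
theorem rpow_neg_le_midpoint {p y : ℝ} (hp : 1 < p) (hy : 1 / 2 < y) :
    y ^ (-p) ≤ ((y - 1 / 2) ^ (1 - p) - (y + 1 / 2) ^ (1 - p)) / (p - 1) := by
  -- the integral over `[y - u, y + u]` minus its midpoint value, scaled by `p - 1`: it vanishes
  -- at `u = 0` and increases with `u`
  let h : ℝ → ℝ := fun u => (y - u) ^ (1 - p) - (y + u) ^ (1 - p) - 2 * u * ((p - 1) * y ^ (-p))
  have hder : ∀ u ∈ Set.Icc (0 : ℝ) (1 / 2), HasDerivAt h
      ((p - 1) * ((y - u) ^ (-p) + (y + u) ^ (-p) - 2 * y ^ (-p))) u := by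
    intro u hu
    have d1 := ((hasDerivAt_id u).const_sub y).rpow_const (p := 1 - p)
      (Or.inl (by have := hu.2; simp only [id]; linarith))
    have d2 := ((hasDerivAt_id u).const_add y).rpow_const (p := 1 - p)
      (Or.inl (by have := hu.1; simp only [id]; linarith))
    have d3 := ((hasDerivAt_id u).const_mul 2).mul_const ((p - 1) * y ^ (-p))
    refine ((d1.sub d2).sub d3).congr_deriv ?_
    simp only [id, show 1 - p - 1 = -p by ring]
    ring
  have hmono : MonotoneOn h (Set.Icc 0 (1 / 2)) := by
    refine monotoneOn_of_deriv_nonneg (convex_Icc _ _)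
      (fun u hu => (hder u hu).continuousAt.continuousWithinAt)
      (fun u hu => (hder u (interior_subset hu)).differentiableAt.differentiableWithinAt) ?_
    intro u hu
    have hu' := interior_subset hu
    rw [(hder u hu').deriv]
    have a1 : 0 < y - u := by linarith [hu'.2]
    have a2 : 0 < y + u := by linarith [hu'.1]
    have hA : 0 < (y - u) ^ (-p) := by positivity
    have hB : 0 < (y + u) ^ (-p) := by positivity
    have hY : 0 < y ^ (-p) := Real.rpow_pos_of_pos (by linarith) _
    -- `(y - u) (y + u) ≤ y ^ 2`, after which AM-GM gives the sign of the derivative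
    have hAB : y ^ (-p) * y ^ (-p) ≤ (y - u) ^ (-p) * (y + u) ^ (-p) := by
      rw [← Real.mul_rpow (by linarith) (by linarith), ← Real.mul_rpow a1.le a2.le]
      exact Real.rpow_le_rpow_of_nonpos (by positivity) (by nlinarith [sq_nonneg u]) (by linarith)
    refine mul_nonneg (by linarith) ?_
    have := abs_le_of_sq_le_sq' (a := 2 * y ^ (-p)) (b := (y - u) ^ (-p) + (y + u) ^ (-p))
      (by nlinarith [sq_nonneg ((y - u) ^ (-p) - (y + u) ^ (-p))]) (by positivity)
    linarith [this.2]
  have := hmono (show (0 : ℝ) ∈ Set.Icc (0 : ℝ) (1 / 2) by simp)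
    (show (1 / 2 : ℝ) ∈ Set.Icc (0 : ℝ) (1 / 2) by simp) (by norm_num)
  rw [le_div_iff₀ (by linarith)]
  simp only [h] at this
  simp only [sub_zero, add_zero, sub_self, mul_zero, zero_mul] at this
  linarith

theorem sum_rpow_neg_le {p c : ℝ} (hp : 1 < p) (hc : 1 / 2 < c) (n : ℕ) :
    ∑ k ∈ Finset.range n, ((k : ℝ) + c) ^ (-p) ≤ (c - 1 / 2) ^ (1 - p) / (p - 1) := by
  have hn : 0 ≤ ((n : ℝ) + c - 1 / 2) ^ (1 - p) / (p - 1) :=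
    div_nonneg (Real.rpow_nonneg (by linarith [n.cast_nonneg (α := ℝ)]) _) (by linarith)
  suffices H : ∑ k ∈ Finset.range n, ((k : ℝ) + c) ^ (-p) ≤
      (c - 1 / 2) ^ (1 - p) / (p - 1) - ((n : ℝ) + c - 1 / 2) ^ (1 - p) / (p - 1) by linarith
  clear hn
  induction n with
  | zero => simp
  | succ n ih =>
    rw [Finset.sum_range_succ]
    have hn0 : (0 : ℝ) ≤ n := n.cast_nonneg
    have := rpow_neg_le_midpoint hp (show 1 / 2 < (n : ℝ) + c by linarith)
    rw [sub_div, show (n : ℝ) + c + 1 / 2 = ((n + 1 : ℕ) : ℝ) + c - 1 / 2 by push_cast; ring] at this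
    linarith

/-! ### Cauchy estimate in the half-plane -/

theorem mem_sector_pi_div_two {a : ℝ} {z : ℂ} (hz : -a ≤ z.re) :
    z ∈ AltSum.sector a (π / 2) := by
  refine ⟨‖z + a‖, (z + a).arg, norm_nonneg _, ?_, ?_⟩
  · rw [Complex.abs_arg_le_pi_div_two_iff, Complex.add_re, Complex.ofReal_re]
    linarith
  · rw [mul_comm Complex.I, Complex.norm_mul_exp_arg_mul_I]
    ring

theorem mem_interior_sector_pi_div_two {a : ℝ} {z : ℂ} (hz : -a < z.re) :
    z ∈ interior (AltSum.sector a (π / 2)) :=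
  mem_interior.2 ⟨{w | -a < w.re}, fun _ hw => mem_sector_pi_div_two (le_of_lt hw),
    isOpen_lt continuous_const Complex.continuous_re, hz⟩

/-- The equality `g x = f x` on the whole real line differentiates termwise on the part of the line
that lies in a half-plane where `g` is analytic. -/
theorem iteratedDeriv_eq_re {f : ℝ → ℝ} {g : ℂ → ℂ} {b : ℝ}
    (hext : ∀ x : ℝ, g x = (f x : ℂ)) (hg : AnalyticOnNhd ℂ g {z | b < z.re}) (k : ℕ) :
    ∀ x : ℝ, b < x → iteratedDeriv k f x = (iteratedDeriv k g x).re := by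
  induction k with
  | zero => intro x _; simp [hext]
  | succ k ih =>
    intro x hx
    have hd : DifferentiableAt ℂ (iteratedDeriv k g) x := by
      rw [iteratedDeriv_eq_iterate]
      exact (hg.iterated_deriv k x (by simpa using hx)).differentiableAt
    rw [iteratedDeriv_succ, iteratedDeriv_succ, ← hd.hasDerivAt.real_of_complex.deriv]
    refine Filter.EventuallyEq.deriv_eq ?_
    filter_upwards [lt_mem_nhds hx] with y hy using ih y hy

/-- Cauchy's estimate on the largest disc around `x` that lies in the half-plane, of radius `x + a`.
There `‖z + a + 1‖ ≤ 2 (x + a) + 1 ≤ 3 (x + a)`, which is the source of the factor `3 ^ lam`. -/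
theorem abs_iteratedDeriv_le {f : ℝ → ℝ} {g : ℂ → ℂ} {a μ lam : ℝ} (hμ : 0 ≤ μ)
    (hlam0 : 0 ≤ lam) (hext : ∀ x : ℝ, g (x : ℂ) = ((f x : ℝ) : ℂ))
    (hcont : ContinuousOn g (AltSum.sector a (π / 2)))
    (hhol : DifferentiableOn ℂ g (interior (AltSum.sector a (π / 2))))
    (hbound : ∀ z ∈ AltSum.sector a (π / 2), ‖g z‖ ≤ μ * ‖z + (a : ℂ) + 1‖ ^ lam)
    (k : ℕ) {x : ℝ} (hx : 1 ≤ x + a) :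
    |iteratedDeriv k f x| ≤ k.factorial * μ * 3 ^ lam * (x + a) ^ (-(k - lam)) := by
  have hpos : 0 < x + a := by linarith
  have hopen : IsOpen {z : ℂ | -a < z.re} := isOpen_lt continuous_const Complex.continuous_re
  have han : AnalyticOnNhd ℂ g {z | -a < z.re} :=
    (hhol.mono fun z hz => mem_interior_sector_pi_div_two hz).analyticOnNhd hopen
  have hre : ∀ z : ℂ, |z.re - x| ≤ ‖z - x‖ := fun z => by
    simpa using Complex.abs_re_le_norm (z - x)
  have hd : DiffContOnCl ℂ g (Metric.ball (x : ℂ) (x + a)) := by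
    refine ⟨hhol.mono fun z hz => mem_interior_sector_pi_div_two ?_,
      hcont.mono fun z hz => mem_sector_pi_div_two ?_⟩
    · have := (abs_lt.1 ((hre z).trans_lt (mem_ball_iff_norm.1 hz))).1
      linarith
    · have := (abs_le.1 ((hre z).trans
        (mem_closedBall_iff_norm.1 (Metric.closure_ball_subset_closedBall hz)))).1
      linarith
  have hC : ∀ z ∈ Metric.sphere (x : ℂ) (x + a), ‖g z‖ ≤ μ * (3 * (x + a)) ^ lam := by
    intro z hz
    have hz' := mem_sphere_iff_norm.1 hz
    have hmem : z ∈ AltSum.sector a (π / 2) := mem_sector_pi_div_two (by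
      have := (abs_le.1 ((hre z).trans hz'.le)).1
      linarith)
    refine (hbound z hmem).trans ?_
    gcongr
    calc ‖z + a + 1‖ = ‖(z - x) + ((x + a + 1 : ℝ) : ℂ)‖ := by push_cast; ring_nf
      _ ≤ (x + a) + (x + a + 1) := by
        refine (norm_add_le _ _).trans ?_
        rw [hz', Complex.norm_of_nonneg (by linarith)]
      _ ≤ 3 * (x + a) := by linarith
  rw [iteratedDeriv_eq_re hext han k x (by linarith)]
  refine (Complex.abs_re_le_norm _).trans
    ((Complex.norm_iteratedDeriv_le_of_forall_mem_sphere_norm_le k hpos hd hC).trans_eq ?_)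
  rw [Real.mul_rpow (by norm_num) hpos.le, neg_sub, Real.rpow_sub hpos, Real.rpow_natCast]
  ring

/-! ### Bounding the remainder -/

/-- No integrability of `F` is assumed: a non-integrable integrand has integral `0`. -/
theorem abs_integral_one_sub_pow_mul_le {F : ℝ → ℝ} {B : ℝ} (k : ℕ)
    (h : ∀ s ∈ Set.Ioc (0 : ℝ) 1, |F s| ≤ B) :
    |∫ s in (0 : ℝ)..1, (1 - s) ^ k * F s| ≤ B / (k + 1) := by
  have hi : ∫ s in (0 : ℝ)..1, (1 - s) ^ k * B = B / (k + 1) := by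
    rw [intervalIntegral.integral_mul_const,
      intervalIntegral.integral_comp_sub_left (fun s => s ^ k) 1]
    simp
    ring
  rw [← hi, ← Real.norm_eq_abs]
  refine intervalIntegral.norm_integral_le_of_norm_le zero_le_one (.of_forall fun s hs => ?_)
    (Continuous.intervalIntegrable (by fun_prop) _ _)
  have : 0 ≤ 1 - s := sub_nonneg.2 hs.2
  rw [Real.norm_eq_abs, abs_mul, abs_of_nonneg (pow_nonneg this k)]
  gcongr
  exact h s hs

/-- No integrability of `F` is assumed: a non-integrable integrand has integral `0`. -/
theorem abs_integral_even_pow_mul_le {F : ℝ → ℝ} {B : ℝ} (m : ℕ)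
    (h : ∀ v ∈ Set.Ioc (-1 : ℝ) 1, |F v| ≤ B) :
    |∫ v in (-1 : ℝ)..1, v ^ (2 * m) * F v| ≤ 2 * B / (2 * m + 1) := by
  have hi : ∫ v in (-1 : ℝ)..1, v ^ (2 * m) * B = 2 * B / (2 * m + 1) := by
    rw [intervalIntegral.integral_mul_const, integral_pow,
      (Even.add_one (even_two_mul m)).neg_one_pow]
    push_cast
    ring
  rw [← hi, ← Real.norm_eq_abs]
  refine intervalIntegral.norm_integral_le_of_norm_le (by norm_num) (.of_forall fun v hv => ?_)
    (Continuous.intervalIntegrable (by fun_prop) _ _)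
  have : 0 ≤ v ^ (2 * m) := by rw [pow_mul]; positivity
  rw [Real.norm_eq_abs, abs_mul, abs_of_nonneg this]
  gcongr
  exact h v hv

/-- The remainder is controlled by the coefficient sum and by the sums of `|f^(2m)|` along
arithmetic progressions of step `1`. The shifts `y = j s v / 2` satisfy `y ≥ -m / 2`. -/
theorem abs_remainder_le {m n : ℕ} (hm : 1 ≤ m) {f : ℝ → ℝ} {A M : ℝ} (hM : 0 ≤ M)
    (hA : ∑ j ∈ Finset.Icc 1 m, |AltSum.gam m j| * (j : ℝ) ^ (2 * m + 1) ≤ A)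
    (hf : ∀ y : ℝ, -(m / 2 : ℝ) ≤ y →
      ∑ k ∈ Finset.range n, |iteratedDeriv (2 * m) f (k + y)| ≤ M) :
    |AltSum.remainder m n f| ≤
      A * M / ((2 * m).factorial * (2 * m + 1) * 4 ^ m) := by
  have hF : ∀ s ∈ Set.Ioc (0 : ℝ) 1, ∀ v ∈ Set.Ioc (-1 : ℝ) 1,
      |∑ j ∈ Finset.Icc 1 m, AltSum.gam m j * (j : ℝ) ^ (2 * m + 1) *
        ∑ k ∈ Finset.range n, iteratedDeriv (2 * m) f ((k : ℝ) + (j : ℝ) * s * v / 2)|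
        ≤ A * M := by
    intro s hs v hv
    calc _ ≤ ∑ j ∈ Finset.Icc 1 m, |AltSum.gam m j| * (j : ℝ) ^ (2 * m + 1) * M := by
          refine (Finset.abs_sum_le_sum_abs _ _).trans (Finset.sum_le_sum fun j hj => ?_)
          rw [abs_mul, abs_mul, abs_of_nonneg (show 0 ≤ (j : ℝ) ^ (2 * m + 1) by positivity)]
          gcongr
          refine (Finset.abs_sum_le_sum_abs _ _).trans (hf _ ?_)
          have hjm : (j : ℝ) ≤ m := by exact_mod_cast (Finset.mem_Icc.1 hj).2
          have hs1 : (j : ℝ) * s ≤ m :=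
            (mul_le_of_le_one_right j.cast_nonneg hs.2).trans hjm
          have hs0 : 0 ≤ (j : ℝ) * s := mul_nonneg j.cast_nonneg hs.1.le
          nlinarith [mul_nonneg hs0 (show 0 ≤ v + 1 by linarith [hv.1])]
      _ ≤ A * M := by
          rw [← Finset.sum_mul]
          gcongr
  have hI := abs_integral_one_sub_pow_mul_le (2 * m - 1) fun s hs =>
    abs_integral_even_pow_mul_le m (hF s hs)
  have hfac : ((2 * m).factorial : ℝ) = 2 * m * (2 * m - 1).factorial := by
    exact_mod_cast (Nat.mul_factorial_pred (by omega : 2 * m ≠ 0)).symm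
  have hm' : (0 : ℝ) < m := by exact_mod_cast hm
  have hcast : ((2 * m - 1 : ℕ) : ℝ) + 1 = 2 * m := by
    rw [Nat.cast_sub (by omega)]
    push_cast
    ring
  rw [hcast] at hI
  rw [AltSum.remainder, abs_mul, abs_of_pos (by positivity)]
  calc _ ≤ 1 / (((2 * m - 1).factorial : ℝ) * 2 ^ (2 * m + 1)) *
        (2 * (A * M) / (2 * m + 1) / (2 * m)) := by gcongr
    _ = _ := by
        rw [hfac, pow_succ, pow_mul, show (2 : ℝ) ^ 2 = 4 by norm_num]
        field_simp

/-- The final estimate with a constant `C` that is determined by the coefficient sum alone; only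
the value of `C` distinguishes `m = 1` from `m ≥ 2`. -/
theorem abs_remainder_le_of_sum_abs_gam_le {m n : ℕ} (hm : 1 ≤ m) {f : ℝ → ℝ} {a μ lam C : ℝ}
    (ha : ((m : ℝ) + 3) / 2 ≤ a) (hμ : 0 ≤ μ) (hlam0 : 0 ≤ lam) (hlam : lam < 2 * (m : ℝ) - 1)
    {g : ℂ → ℂ} (hext : ∀ x : ℝ, g (x : ℂ) = ((f x : ℝ) : ℂ))
    (hcont : ContinuousOn g (AltSum.sector a (π / 2)))
    (hhol : DifferentiableOn ℂ g (interior (AltSum.sector a (π / 2))))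
    (hbound : ∀ z ∈ AltSum.sector a (π / 2), ‖g z‖ ≤ μ * ‖z + (a : ℂ) + 1‖ ^ lam)
    (hC : ∑ j ∈ Finset.Icc 1 m, |AltSum.gam m j| * (j : ℝ) ^ (2 * m + 1) ≤
      C * π * AltSum.LamStar ^ m * (m : ℝ) ^ (2 * m + 1)) :
    |AltSum.remainder m n f| ≤
      C * π * μ * (3 : ℝ) ^ lam / ((2 * (m : ℝ) + 1) * (2 * (m : ℝ) - 1 - lam)) *
        (AltSum.LamStar / 4) ^ m *
        ((m : ℝ) ^ (2 * m + 1) / (a - (m : ℝ) / 2 - 1 / 2) ^ (2 * (m : ℝ) - 1 - lam)) := by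
  have hq : 0 < 2 * (m : ℝ) - 1 - lam := by linarith
  have hb : 0 < a - (m : ℝ) / 2 - 1 / 2 := by linarith
  have hsum : ∀ y : ℝ, -(m / 2 : ℝ) ≤ y →
      ∑ k ∈ Finset.range n, |iteratedDeriv (2 * m) f (k + y)| ≤
        (2 * m).factorial * μ * 3 ^ lam *
          ((a - (m : ℝ) / 2 - 1 / 2) ^ (-(2 * (m : ℝ) - 1 - lam)) / (2 * (m : ℝ) - 1 - lam)) := by
    intro y hy
    have hs := sum_rpow_neg_le (p := 2 * m - lam) (c := y + a) (by linarith) (by linarith) n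
    calc _ ≤ ∑ k ∈ Finset.range n, (2 * m).factorial * μ * 3 ^ lam *
          ((k : ℝ) + (y + a)) ^ (-(2 * m - lam)) := by
          refine Finset.sum_le_sum fun k _ => ?_
          have hk : (0 : ℝ) ≤ k := k.cast_nonneg
          refine (abs_iteratedDeriv_le hμ hlam0 hext hcont hhol hbound (2 * m)
            (by linarith)).trans_eq ?_
          push_cast
          rw [add_assoc]
      _ ≤ _ := by
          rw [← Finset.mul_sum]
          gcongr
          refine hs.trans ?_
          rw [show 1 - (2 * (m : ℝ) - lam) = -(2 * m - 1 - lam) by ring,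
            show 2 * (m : ℝ) - lam - 1 = 2 * m - 1 - lam by ring]
          gcongr ?_ / _
          exact Real.rpow_le_rpow_of_nonpos hb (by linarith) (by linarith)
  refine (abs_remainder_le hm (by positivity) hC hsum).trans_eq ?_
  rw [Real.rpow_neg hb.le, div_pow]
  field_simp

theorem corollary5 (m n : ℕ) (hm : 1 ≤ m) (f : ℝ → ℝ) (a μ lam : ℝ)
    (ha : ((m : ℝ) + 3) / 2 ≤ a) (hμ : 0 ≤ μ) (hlam0 : 0 ≤ lam) (hlam : lam < 2 * (m : ℝ) - 1)
    (g : ℂ → ℂ) (hext : ∀ x : ℝ, g (x : ℂ) = ((f x : ℝ) : ℂ))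
    (hcont : ContinuousOn g (AltSum.sector a (Real.pi / 2)))
    (hhol : DifferentiableOn ℂ g (interior (AltSum.sector a (Real.pi / 2))))
    (hbound : ∀ z ∈ AltSum.sector a (Real.pi / 2), ‖g z‖ ≤ μ * ‖z + (a : ℂ) + 1‖ ^ lam) :
    (2 ≤ m → |AltSum.remainder m n f| ≤
      1.001 * Real.pi * μ * (3 : ℝ) ^ lam / ((2 * (m : ℝ) + 1) * (2 * (m : ℝ) - 1 - lam)) *
        (AltSum.LamStar / 4) ^ m *
        ((m : ℝ) ^ (2 * m + 1) / (a - (m : ℝ) / 2 - 1 / 2) ^ (2 * (m : ℝ) - 1 - lam))) ∧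
    (m = 1 → |AltSum.remainder m n f| ≤
      1.0331 * Real.pi * μ * (3 : ℝ) ^ lam / ((2 * (m : ℝ) + 1) * (2 * (m : ℝ) - 1 - lam)) *
        (AltSum.LamStar / 4) ^ m *
        ((m : ℝ) ^ (2 * m + 1) / (a - (m : ℝ) / 2 - 1 / 2) ^ (2 * (m : ℝ) - 1 - lam))) := by
  refine ⟨fun hm2 => ?_, fun hm1 => ?_⟩
  · exact abs_remainder_le_of_sum_abs_gam_le hm ha hμ hlam0 hlam hext hcont hhol hbound
      (sum_abs_gam_le hm2)
  · refine abs_remainder_le_of_sum_abs_gam_le hm ha hμ hlam0 hlam hext hcont hhol hbound ?_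
    subst hm1
    simpa [AltSum.gam] using one_le_mul_lamStar
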